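/- Let $P$ be a stochastic $K\times K$ matrix (the transition matrix of a Markov channel) with a steady-state distribution $p^s$, $p^sP=p^s$. For $j\in\{1,\dots,K\}$ and $\tau\ge 1$ let $\vec\pi_j^\tau=\vec e_jP^\tau=(p^{(\tau)}_{j1},\dots,p^{(\tau)}_{jK})$ be the belief about the channel when it was last observed $\tau$ slots ago in state $j$. Let $R^1\in\mathbb R$ and $R(\vec\pi_j^\tau,0)\in\mathbb R$ be the average immediate rewards of the active action ($a=1$, a pilot is allocated) and of the passive action ($a=0$), and let $W\in\mathbb R$ be fixed. Assume (A1) $\max_i p_{ji}^{(\tau)}\ge\max_i p_{ji}^{(\tau')}$ for all $j$ and all $\tau\le\tau'$; (A2) $R^1\ge R(\vec\pi_j^\tau,0)\ge R(\vec\pi_j^{\tau'},0)$ for all $j$ and all $\tau\le\tau'$. Consider the controlled Markov chain with states $\vec\pi_j^\tau$ (labelled by the pairs $(j,\tau)$) and actions $a\in\{0,1\}$: under $a=0$ the state moves from $\vec\pi_j^\tau$ to $\vec\pi_j^{\tau+1}$, with reward $R(\vec\pi_j^\tau,0)+W$; under $a=1$ it moves to $\vec\pi_k^1$ with probability $p_k^s$,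 with reward $R^1$. For $\vec\Gamma\in\{0,1,\dots,\infty\}^K$, the threshold policy $\vec\Gamma$ is passive in $\vec\pi_j^\tau$ if $\tau\le\Gamma_j$ and active if $\tau>\Gamma_j$. Then there exists $\vec\Gamma=(\Gamma_1,\dots,\Gamma_K)\in\{0,1,\dots,\infty\}^K$ such that, from every initial state, the threshold policy $\vec\Gamma$ maximizes the long-run expected average reward $$\liminf_{T\to\infty}\frac1T\,\mathbb E\Big(\sum_{t=1}^T r_t\Big)$$ ($r_t$ being the reward in slot $t$) among all history-dependent randomized policies. Moreover, $\Gamma_j=\infty$ occurs only if never allocating a pilot is optimal from every state $\vec\pi_j^\tau$, $\tau\ge1$; in particular, all $\Gamma_j$ are finite if never allocating a pilot is not optimal from any initial state. -/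

import Mathlib

open scoped ENNReal Matrix

noncomputable section

namespace PilotArm

/-- The data of one user (one arm) with `K` channel states: the channel transition matrix `P`,
a steady-state distribution `pS` of `P`, the average immediate reward `R1` of the active action
(a pilot is allocated), and the average immediate reward `R0 b` of the passive action in
belief state `b`. -/
structure Arm (K : ℕ) where
  P : Matrix (Fin K) (Fin K) ℝ
  P_nonneg : ∀ i j, 0 ≤ P i j
  P_row_sum : ∀ i, ∑ j, P i j = 1
  pS : Fin K → ℝ
  pS_nonneg : ∀ j, 0 ≤ pS j
  pS_sum : ∑ j, pS j = 1
  pS_steady : pS ᵥ* P = pS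
  R1 : ℝ
  R0 : (Fin K → ℝ) → ℝ

/-- The state `(j, τ)`: the channel was last observed `τ` slots ago, and it was in state `j`.
It stands for the belief state `π_j^τ`. -/
abbrev State (K : ℕ) := Fin K × ℕ+

/-- Actions: `true` is active (allocate a pilot), `false` is passive. -/
abbrev Action := Bool

namespace Arm

variable {K : ℕ} (M : Arm K)

/-- The belief vector `π_j^τ = e_j P^τ`. -/
def belief (j : Fin K) (τ : ℕ+) : Fin K → ℝ := Pi.single j 1 ᵥ* M.P ^ (τ : ℕ)

/-- Assumption A1: `max_i p_{ji}^{(τ)}` is non-increasing in `τ`. -/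
def A1 : Prop :=
  ∀ (j : Fin K) (τ τ' : ℕ+), τ ≤ τ' → ⨆ i, M.belief j τ' i ≤ ⨆ i, M.belief j τ i

/-- Assumption A2: `R¹ ≥ R(π_j^τ, 0) ≥ R(π_j^τ', 0)` for `τ ≤ τ'`. -/
def A2 : Prop :=
  ∀ (j : Fin K) (τ τ' : ℕ+), τ ≤ τ' →
    M.R0 (M.belief j τ) ≤ M.R1 ∧ M.R0 (M.belief j τ') ≤ M.R0 (M.belief j τ)

/-- The steady-state distribution as a probability mass function. -/
def steady : PMF (Fin K) :=
  PMF.ofFintype (fun j => ENNReal.ofReal (M.pS j)) (by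
    rw [← ENNReal.ofReal_sum_of_nonneg fun j _ => M.pS_nonneg j, M.pS_sum, ENNReal.ofReal_one])

/-- The transition law of the approximation. Passive: `π_j^τ` moves to `π_j^{τ+1}`.
Active: the next state is `π_k^1` with probability `p_k^s`. -/
def next (x : State K) : Action → PMF (State K)
  | false => PMF.pure (x.1, x.2 + 1)
  | true => M.steady.map fun k => (k, 1)

/-- One-slot reward with subsidy `W` for passivity. -/
def reward (W : ℝ) (x : State K) : Action → ℝ
  | false => M.R0 (M.belief x.1 x.2) + W
  | true => M.R1

end Arm

/-- A history-dependent randomized policy: from the past states and actions (most recent first)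
and the current state to a distribution over the actions. -/
abbrev Policy (K : ℕ) := List (State K × Action) → State K → PMF Action

/-- The threshold policy `Γ`: passive in `π_j^τ` if `τ ≤ Γ_j` and active if `τ > Γ_j`
(never active while the last observed channel state is `j` if `Γ_j = ∞`). -/
def thresholdPolicy {K : ℕ} (Γ : Fin K → ℕ∞) : Policy K :=
  fun _ x => PMF.pure (decide (Γ x.1 < ((x.2 : ℕ) : ℕ∞)))

namespace Arm

/-- The law of the history and the current state after `t` slots, from the initial state `x₀`. -/
def historyLaw {K : ℕ} (M : Arm K) (φ : Policy K) (x₀ : State K) : ℕ → PMF (List (State K × Action) × State K)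
  | 0 => PMF.pure ([], x₀)
  | t + 1 => (historyLaw M φ x₀ t).bind fun z =>
      (φ z.1 z.2).bind fun a => (M.next z.2 a).map fun y => ((z.2, a) :: z.1, y)

/-- The law of the state and the action in slot `t` (the first slot is `t = 0`). -/
def stateActionLaw {K : ℕ} (M : Arm K) (φ : Policy K) (x₀ : State K) (t : ℕ) : PMF (State K × Action) :=
  (M.historyLaw φ x₀ t).bind fun z => (φ z.1 z.2).map fun a => (z.2, a)

/-- The expected reward in slot `t`. The law has finite support, so the sum is a finite one. -/
def expectedReward {K : ℕ} (M : Arm K) (W : ℝ) (φ : Policy K) (x₀ : State K) (t : ℕ) : ℝ :=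
  ∑' xa : State K × Action, (M.stateActionLaw φ x₀ t xa).toReal * M.reward W xa.1 xa.2

/-- The long-run expected average reward `liminf_T (1/T) E ∑_{t<T} reward`, an extended real. -/
def averageReward {K : ℕ} (M : Arm K) (W : ℝ) (φ : Policy K) (x₀ : State K) : EReal :=
  Filter.liminf
    (fun T : ℕ => (((1 / (T : ℝ)) * ∑ t ∈ Finset.range T, M.expectedReward W φ x₀ t : ℝ) : EReal))
    Filter.atTop

/-- `φ` maximizes the long-run expected average reward from `x₀` among all policies. -/
def IsOptimalFrom {K : ℕ} (M : Arm K) (W : ℝ) (φ : Policy K) (x₀ : State K) : Prop :=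
  ∀ ψ : Policy K, M.averageReward W ψ x₀ ≤ M.averageReward W φ x₀

/-- `φ` is optimal: it maximizes the average reward from every initial state. -/
def IsOptimal {K : ℕ} (M : Arm K) (W : ℝ) (φ : Policy K) : Prop :=
  ∀ x₀ : State K, M.IsOptimalFrom W φ x₀

end Arm

end PilotArm

end

/-! The optimality of a threshold policy is proved by a verification argument.

The states `(j, τ)` with fixed `j` are called the class `j`. Write `q j n` for the reward
of the passive action in the state `(j, n + 1)`; by A2 it is nonincreasing in `n`. An active slot starts a renewal, so against a target gain `g` the best that a
renewal cycle started in `(k, 1)` can collect in its passive slots is the sum of the positive parts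
`(q k n - g)⁺`. Let `g` be the least real number with
`R¹ + ∑ₖ pₖˢ ∑ₙ (q k n - g)⁺ ≤ g` (`exists_isLeast_dominatesCycles`), and let `Γ` be passive exactly
in the states with `q j n ≥ g`. This is a threshold rule since `q j` is nonincreasing.

*Upper bound* (`averageReward_le_of_dominatesCycles`). The function
`h (j, n + 1) = ∑ₛ (q j (n + s) - v)⁺` satisfies the average-reward Bellman inequality for the gain
`v ≥ g` on all states that are reachable from the class `j`, provided that `q j` is eventually at
most `v`. Telescoping bounds the average reward of every policy by `v`.

*Lower bound* (`le_averageReward_thresholdPolicy`). If no class that renewals reach stays passive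
for ever, minimality of `g` turns the defining inequality into an equality, and `h` with `v = g`
satisfies the reverse Bellman inequality along `Γ`. If some class `k` with `pₖˢ > 0` stays passive
for ever, the defining inequality may be strict; the reverse inequality is then restored by adding a
large constant to `h` on the classes that `Γ` never leaves. So `Γ` has average reward at least `g`
from every state.

If `Γ j` is finite, then `q j` drops below `g`, the upper bound holds with `v = g`, and `Γ` is optimal
from `(j, τ)`. If `Γ j = ∞`, then from `(j, τ)` both `Γ` and the policy that never allocates a pilot
earn at least `⨅ n, q j n` in every slot, and the upper bound holds for each `v > ⨅ n, q j n`. -/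

open Filter Topology

namespace PilotArm

/-! ### Expectations under finitely supported laws -/

/-- The expectation of a real function under a probability mass function. It is used only for
finitely supported laws, where the sum is a finite one. -/
noncomputable def expect {α : Type*} (p : PMF α) (f : α → ℝ) : ℝ :=
  ∑' x, (p x).toReal * f x

section Expect

variable {α β : Type*} {p : PMF α} {f f' : α → ℝ}

lemma expect_eq_sum {s : Finset α} (hs : p.support ⊆ s) (f : α → ℝ) :
    expect p f = ∑ x ∈ s, (p x).toReal * f x := by
  refine tsum_eq_sum fun x hx => ?_
  have : p x = 0 := by
    by_contra h
    exact hx (hs ((PMF.mem_support_iff _ _).2 h))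
  simp [this]

lemma expect_pure (a : α) (f : α → ℝ) : expect (PMF.pure a) f = f a := by
  rw [expect_eq_sum (s := {a}) (by simp)]
  simp

lemma expect_bind (hp : p.support.Finite) {q : α → PMF β} (hq : ∀ a, (q a).support.Finite)
    (f : β → ℝ) : expect (p.bind q) f = expect p fun a => expect (q a) f := by
  classical
  rw [expect_eq_sum (s := hp.toFinset) (by simp)]
  have hs : (p.bind q).support ⊆ (hp.toFinset.biUnion fun a => (hq a).toFinset : Finset β) := by
    intro b
    simp
  rw [expect_eq_sum hs]
  have hb : ∀ b, (p.bind q b).toReal = ∑ a ∈ hp.toFinset, (p a).toReal * (q a b).toReal := by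
    intro b
    rw [PMF.bind_apply, tsum_eq_sum (s := hp.toFinset), ENNReal.toReal_sum]
    · simp
    · exact fun a _ => ENNReal.mul_ne_top (p.apply_ne_top a) ((q a).apply_ne_top b)
    · intro a ha
      have : p a = 0 := by simpa using ha
      simp [this]
  simp_rw [hb, Finset.sum_mul]
  rw [Finset.sum_comm]
  refine Finset.sum_congr rfl fun a ha => ?_
  have ha' : (q a).support ⊆ (hp.toFinset.biUnion fun a => (hq a).toFinset : Finset β) := by
    intro b hb
    simp only [Finset.coe_biUnion, Set.mem_iUnion, Set.Finite.coe_toFinset]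
    exact ⟨a, by simpa using ha, hb⟩
  rw [expect_eq_sum ha', Finset.mul_sum]
  exact Finset.sum_congr rfl fun b _ => by ring

lemma expect_map (hp : p.support.Finite) (g : α → β) (f : β → ℝ) :
    expect (p.map g) f = expect p fun a => f (g a) := by
  rw [← PMF.bind_pure_comp, expect_bind hp fun a => by simp]
  simp [expect_pure]

lemma expect_add (hp : p.support.Finite) (f f' : α → ℝ) :
    expect p (fun x => f x + f' x) = expect p f + expect p f' := by
  have hs : p.support ⊆ hp.toFinset := by simp
  simp only [expect_eq_sum hs, mul_add, Finset.sum_add_distrib]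

lemma expect_mono (hp : p.support.Finite) (h : ∀ x ∈ p.support, f x ≤ f' x) :
    expect p f ≤ expect p f' := by
  have hs : p.support ⊆ hp.toFinset := by simp
  rw [expect_eq_sum hs, expect_eq_sum hs]
  exact Finset.sum_le_sum fun x hx =>
    mul_le_mul_of_nonneg_left (h x (by simpa using hx)) ENNReal.toReal_nonneg

lemma expect_const (hp : p.support.Finite) (c : ℝ) : expect p (fun _ => c) = c := by
  have hs : p.support ⊆ hp.toFinset := by simp
  have h1 : ∑ x ∈ hp.toFinset, p x = 1 := by
    rw [← p.tsum_coe]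
    refine (tsum_eq_sum fun x hx => ?_).symm
    simpa using hx
  rw [expect_eq_sum hs, ← Finset.sum_mul,
    ← ENNReal.toReal_sum fun a _ => p.apply_ne_top a, h1, ENNReal.toReal_one, one_mul]

end Expect

namespace Arm

variable {K : ℕ} (M : Arm K) (W : ℝ)

/-! ### Telescoping Bellman inequalities along a policy -/

lemma finite_support_next (x : State K) (a : Action) : (M.next x a).support.Finite := by
  cases a
  · simp [next]
  · simpa [next, PMF.support_map] using (Set.toFinite _).image _

lemma expect_next_false (x : State K) (f : State K → ℝ) :
    expect (M.next x false) f = f (x.1, x.2 + 1) := by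
  rw [next, expect_pure]

lemma expect_next_true (x : State K) (f : State K → ℝ) :
    expect (M.next x true) f = ∑ k, M.pS k * f (k, 1) := by
  rw [next, expect_map (Set.toFinite _), expect_eq_sum (s := Finset.univ) (by simp)]
  refine Finset.sum_congr rfl fun k _ => ?_
  rw [steady, PMF.ofFintype_apply, ENNReal.toReal_ofReal (M.pS_nonneg k)]

lemma pS_pos_of_mem_support_next_true {x y : State K} (hy : y ∈ (M.next x true).support) :
    0 < M.pS y.1 := by
  simp only [next, PMF.support_map, Set.mem_image, PMF.mem_support_iff] at hy
  obtain ⟨k, hk, rfl⟩ := hy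
  simpa [steady] using hk

variable {M W} {φ : Policy K} {x₀ : State K} {I : Set (State K)} {h : State K → ℝ} {v : ℝ}

lemma finite_support_historyLaw (t : ℕ) : (M.historyLaw φ x₀ t).support.Finite := by
  induction t with
  | zero => simp [historyLaw]
  | succ t ih =>
    rw [historyLaw, PMF.support_bind]
    refine ih.biUnion fun z _ => ?_
    rw [PMF.support_bind]
    refine (Set.toFinite _).biUnion fun a _ => ?_
    rw [PMF.support_map]
    exact (M.finite_support_next _ _).image _

lemma expectedReward_eq (t : ℕ) :
    M.expectedReward W φ x₀ t = expect (M.historyLaw φ x₀ t) fun z =>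
      expect (φ z.1 z.2) fun a => M.reward W z.2 a := by
  change expect (M.stateActionLaw φ x₀ t) (fun xa => M.reward W xa.1 xa.2) = _
  rw [stateActionLaw, expect_bind (finite_support_historyLaw t)]
  · simp_rw [expect_map (Set.toFinite _)]
  · intro z
    rw [PMF.support_map]
    exact (Set.toFinite _).image _

lemma expect_historyLaw_succ (t : ℕ) (h : State K → ℝ) :
    (expect (M.historyLaw φ x₀ (t + 1)) fun z => h z.2) = expect (M.historyLaw φ x₀ t) fun z =>
      expect (φ z.1 z.2) fun a => expect (M.next z.2 a) h := by
  have hfin : ∀ (z : List (State K × Action) × State K) (a : Action),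
      ((M.next z.2 a).map fun y => ((z.2, a) :: z.1, y)).support.Finite := by
    intro z a
    rw [PMF.support_map]
    exact (M.finite_support_next _ _).image _
  rw [historyLaw, expect_bind (finite_support_historyLaw t)]
  · congr 1
    funext z
    rw [expect_bind (Set.toFinite _) (hfin z)]
    simp_rw [expect_map (M.finite_support_next _ _)]
  · intro z
    rw [PMF.support_bind]
    exact (Set.toFinite _).biUnion fun a _ => hfin z a

lemma mem_of_mem_support_historyLaw (hx₀ : x₀ ∈ I)
    (hI : ∀ l, ∀ x ∈ I, ∀ a ∈ (φ l x).support, (M.next x a).support ⊆ I) (t : ℕ) :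
    ∀ z ∈ (M.historyLaw φ x₀ t).support, z.2 ∈ I := by
  induction t with
  | zero => simpa [historyLaw] using hx₀
  | succ t ih =>
    intro z hz
    simp only [historyLaw, PMF.support_bind, PMF.support_map, Set.mem_iUnion, Set.mem_image] at hz
    obtain ⟨w, hw, a, ha, y, hy, rfl⟩ := hz
    exact hI _ _ (ih w hw) a ha hy

/-- The Bellman inequality with gain `v` and relative value function `h ≥ 0`, required only on an
invariant set `I` of states, bounds the average reward by `v`. -/
lemma averageReward_le_of_bellman (hx₀ : x₀ ∈ I)
    (hI : ∀ l, ∀ x ∈ I, ∀ a ∈ (φ l x).support, (M.next x a).support ⊆ I)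
    (hB : ∀ l, ∀ x ∈ I, ∀ a ∈ (φ l x).support,
      M.reward W x a + expect (M.next x a) h ≤ v + h x)
    (h0 : ∀ x, 0 ≤ h x) : M.averageReward W φ x₀ ≤ v := by
  have step : ∀ t, M.expectedReward W φ x₀ t +
      (expect (M.historyLaw φ x₀ (t + 1)) fun z => h z.2) ≤
        v + expect (M.historyLaw φ x₀ t) fun z => h z.2 := by
    intro t
    have hf := finite_support_historyLaw (M := M) (φ := φ) (x₀ := x₀) t
    rw [expectedReward_eq, expect_historyLaw_succ, ← expect_add hf, ← expect_const hf v,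
      ← expect_add hf]
    refine expect_mono hf fun z hz => ?_
    have hz' := mem_of_mem_support_historyLaw hx₀ hI t z hz
    rw [← expect_add (Set.toFinite _),
      ← expect_const (p := φ z.1 z.2) (Set.toFinite _) (v + h z.2)]
    exact expect_mono (Set.toFinite _) fun a ha => hB _ _ hz' a ha
  have tele : ∀ T : ℕ, ∑ t ∈ Finset.range T, M.expectedReward W φ x₀ t +
      (expect (M.historyLaw φ x₀ T) fun z => h z.2) ≤ T * v + h x₀ := by
    intro T
    induction T with
    | zero => simp [historyLaw, expect_pure]
    | succ T ih =>
      rw [Finset.sum_range_succ]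
      push_cast
      linarith [step T]
  have lim : Tendsto (fun T : ℕ => ((v + h x₀ / T : ℝ) : EReal)) atTop (𝓝 (v : EReal)) := by
    rw [EReal.tendsto_coe]
    simpa using tendsto_const_nhds.add (tendsto_const_div_atTop_nhds_zero_nat (h x₀))
  rw [averageReward, ← lim.liminf_eq]
  refine liminf_le_liminf ?_
  filter_upwards [eventually_gt_atTop 0] with T hT
  have hT' : (0 : ℝ) < T := by exact_mod_cast hT
  have hnn : 0 ≤ expect (M.historyLaw φ x₀ T) fun z => h z.2 := by
    rw [← expect_const (finite_support_historyLaw (M := M) (φ := φ) (x₀ := x₀) T) 0]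
    exact expect_mono (finite_support_historyLaw T) fun z _ => h0 _
  rw [EReal.coe_le_coe_iff, one_div, inv_mul_le_iff₀ hT', mul_add, mul_div_cancel₀ _ hT'.ne']
  linarith [tele T]

/-- The reverse Bellman inequality along a policy, with gain `v` and a relative value function that
is bounded above, bounds the average reward of that policy from below by `v`. -/
lemma le_averageReward_of_bellman (hx₀ : x₀ ∈ I)
    (hI : ∀ l, ∀ x ∈ I, ∀ a ∈ (φ l x).support, (M.next x a).support ⊆ I)
    (hB : ∀ l, ∀ x ∈ I, ∀ a ∈ (φ l x).support,
      v + h x ≤ M.reward W x a + expect (M.next x a) h)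
    {B : ℝ} (hh : ∀ x, h x ≤ B) : (v : EReal) ≤ M.averageReward W φ x₀ := by
  have step : ∀ t, v + (expect (M.historyLaw φ x₀ t) fun z => h z.2) ≤
      M.expectedReward W φ x₀ t + expect (M.historyLaw φ x₀ (t + 1)) fun z => h z.2 := by
    intro t
    have hf := finite_support_historyLaw (M := M) (φ := φ) (x₀ := x₀) t
    rw [expectedReward_eq, expect_historyLaw_succ, ← expect_add hf, ← expect_const hf v,
      ← expect_add hf]
    refine expect_mono hf fun z hz => ?_
    have hz' := mem_of_mem_support_historyLaw hx₀ hI t z hz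
    rw [← expect_add (Set.toFinite _),
      ← expect_const (p := φ z.1 z.2) (Set.toFinite _) (v + h z.2)]
    exact expect_mono (Set.toFinite _) fun a ha => hB _ _ hz' a ha
  have tele : ∀ T : ℕ, T * v + h x₀ ≤ ∑ t ∈ Finset.range T, M.expectedReward W φ x₀ t +
      (expect (M.historyLaw φ x₀ T) fun z => h z.2) := by
    intro T
    induction T with
    | zero => simp [historyLaw, expect_pure]
    | succ T ih =>
      rw [Finset.sum_range_succ]
      push_cast
      linarith [step T]
  have lim : Tendsto (fun T : ℕ => ((v + (h x₀ - B) / T : ℝ) : EReal)) atTop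
      (𝓝 (v : EReal)) := by
    rw [EReal.tendsto_coe]
    simpa using tendsto_const_nhds.add (tendsto_const_div_atTop_nhds_zero_nat (h x₀ - B))
  rw [averageReward, ← lim.liminf_eq]
  refine liminf_le_liminf ?_
  filter_upwards [eventually_gt_atTop 0] with T hT
  have hT' : (0 : ℝ) < T := by exact_mod_cast hT
  have hle : (expect (M.historyLaw φ x₀ T) fun z => h z.2) ≤ B := by
    rw [← expect_const (finite_support_historyLaw (M := M) (φ := φ) (x₀ := x₀) T) B]
    exact expect_mono (finite_support_historyLaw T) fun z _ => hh _
  rw [EReal.coe_le_coe_iff, one_div, le_inv_mul_iff₀ hT', mul_add, mul_div_cancel₀ _ hT'.ne']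
  linarith [tele T]

/-! ### The optimal gain -/

variable (M W)

/-- The reward of the passive action in the state `(j, n + 1)`; the shift makes the index a natural
number. -/
noncomputable def passiveReward (j : Fin K) (n : ℕ) : ℝ :=
  M.R0 (M.belief j n.succPNat) + W

/-- The excess of the passive reward in the state `(j, n + 1)` over `g`, cut off at zero. -/
noncomputable def excess (g : ℝ) (j : Fin K) (n : ℕ) : ℝ :=
  max (M.passiveReward W j n - g) 0

/-- The total excess over `g` from the state `(j, n + 1)` on under passivity. It has the junk value
`0` if the sum diverges. -/
noncomputable def totalExcess (g : ℝ) (j : Fin K) (n : ℕ) : ℝ :=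
  ∑' s, M.excess W g j (n + s)

/-- No renewal cycle, started from the steady-state distribution and ended by an active slot, gains
more than `g` per slot on average. Partial sums are used so that no convergence is presupposed. -/
def DominatesCycles (g : ℝ) : Prop :=
  ∀ N, M.R1 + ∑ k, M.pS k * ∑ n ∈ Finset.range N, M.excess W g k n ≤ g

variable {M W} {g : ℝ} {j : Fin K}

lemma passiveReward_antitone (hA2 : M.A2) (j : Fin K) : Antitone (M.passiveReward W j) := by
  intro m n hmn
  have := (hA2 j m.succPNat n.succPNat (Nat.succPNat_le_succPNat.2 hmn)).2
  simpa [passiveReward] using this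

lemma natPred_add_one (τ : ℕ+) : (τ + 1).natPred = τ.natPred + 1 := by
  have := τ.pos
  simp only [PNat.natPred, PNat.add_coe, PNat.one_coe]
  omega

lemma reward_false (x : State K) :
    M.reward W x false = M.passiveReward W x.1 x.2.natPred := by
  simp [reward, passiveReward]

lemma excess_nonneg (n : ℕ) : 0 ≤ M.excess W g j n := le_max_right _ _

lemma excess_eq_zero {n : ℕ} (h : M.passiveReward W j n ≤ g) : M.excess W g j n = 0 :=
  max_eq_right (sub_nonpos.2 h)

lemma totalExcess_nonneg (n : ℕ) : 0 ≤ M.totalExcess W g j n :=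
  tsum_nonneg fun _ => excess_nonneg _

lemma totalExcess_eq_zero (hA2 : M.A2) {n : ℕ} (h : M.passiveReward W j n ≤ g) :
    M.totalExcess W g j n = 0 := by
  have : ∀ s, M.excess W g j (n + s) = 0 := fun s =>
    excess_eq_zero ((passiveReward_antitone hA2 j (Nat.le_add_right n s)).trans h)
  simp [totalExcess, this]

lemma totalExcess_eq_add (hs : Summable (M.excess W g j)) (n : ℕ) :
    M.totalExcess W g j n = M.excess W g j n + M.totalExcess W g j (n + 1) := by
  have h : Summable fun s => M.excess W g j (n + s) := by
    simpa only [add_comm n] using (summable_nat_add_iff n).2 hs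
  rw [totalExcess, h.tsum_eq_zero_add, totalExcess]
  simp only [add_zero, add_assoc, add_comm 1]

lemma totalExcess_le (hs : Summable (M.excess W g j)) (n : ℕ) :
    M.totalExcess W g j n ≤ M.totalExcess W g j 0 := by
  induction n with
  | zero => exact le_rfl
  | succ n ih =>
    have := excess_nonneg (M := M) (W := W) (g := g) (j := j) n
    linarith [totalExcess_eq_add hs n]

lemma totalExcess_eq_zero_of_not_summable (hs : ¬ Summable (M.excess W g j)) (n : ℕ) :
    M.totalExcess W g j n = 0 := by
  refine tsum_eq_zero_of_not_summable fun h => hs ((summable_nat_add_iff n).1 ?_)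
  simpa only [add_comm n] using h

lemma summable_excess (hA2 : M.A2) {N : ℕ} (h : M.passiveReward W j N ≤ g) :
    Summable (M.excess W g j) :=
  summable_of_ne_finset_zero (s := Finset.range N) fun n hn =>
    excess_eq_zero ((passiveReward_antitone hA2 j (by simpa using hn)).trans h)

lemma excess_anti {g g' : ℝ} (h : g ≤ g') (n : ℕ) : M.excess W g' j n ≤ M.excess W g j n :=
  max_le_max (by linarith) le_rfl

lemma DominatesCycles.mono {g g' : ℝ} (hg : M.DominatesCycles W g) (h : g ≤ g') :
    M.DominatesCycles W g' := by
  intro N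
  refine le_trans ?_ ((hg N).trans h)
  gcongr with k _ n _
  · exact M.pS_nonneg k
  · exact excess_anti h n

lemma DominatesCycles.R1_le (hg : M.DominatesCycles W g) : M.R1 ≤ g := by
  simpa using hg 0

lemma DominatesCycles.summable_excess (hg : M.DominatesCycles W g) (hj : 0 < M.pS j) :
    Summable (M.excess W g j) := by
  refine summable_of_sum_range_le (c := (g - M.R1) / M.pS j) (fun n => excess_nonneg n)
    fun N => ?_
  rw [le_div_iff₀ hj, mul_comm]
  have := Finset.single_le_sum (f := fun k => M.pS k * ∑ n ∈ Finset.range N, M.excess W g k n)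
    (fun k _ => mul_nonneg (M.pS_nonneg k) (Finset.sum_nonneg fun n _ => excess_nonneg n))
    (Finset.mem_univ j)
  linarith [hg N]

lemma DominatesCycles.totalExcess_le (hg : M.DominatesCycles W g) :
    M.R1 + ∑ k, M.pS k * M.totalExcess W g k 0 ≤ g := by
  suffices h : Tendsto (fun N => M.R1 + ∑ k, M.pS k * ∑ n ∈ Finset.range N, M.excess W g k n)
      atTop (𝓝 (M.R1 + ∑ k, M.pS k * M.totalExcess W g k 0)) from le_of_tendsto' h hg
  refine tendsto_const_nhds.add (tendsto_finsetSum _ fun k _ => ?_)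
  rcases (M.pS_nonneg k).eq_or_lt with hk | hk
  · simp [← hk]
  · have := (hg.summable_excess hk).hasSum.tendsto_sum_nat
    simpa [totalExcess] using this.const_mul (M.pS k)

lemma continuous_excess (n : ℕ) : Continuous fun g => M.excess W g j n := by
  unfold excess
  fun_prop

lemma exists_isLeast_dominatesCycles (hA2 : M.A2) : ∃ g, IsLeast {g | M.DominatesCycles W g} g := by
  have hcl : IsClosed {g | M.DominatesCycles W g} := by
    simp only [DominatesCycles, Set.ofPred_forall]
    refine isClosed_iInter fun N => isClosed_le ?_ continuous_id
    exact continuous_const.add (continuous_finsetSum _ fun k _ =>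
      continuous_const.mul (continuous_finsetSum _ fun n _ => continuous_excess n))
  have hne : {g | M.DominatesCycles W g}.Nonempty := by
    obtain ⟨b, hb⟩ := (Set.finite_range fun k => M.passiveReward W k 0).bddAbove
    refine ⟨max b M.R1, fun N => ?_⟩
    have h0 : ∀ k n, M.excess W (max b M.R1) k n = 0 := fun k n =>
      excess_eq_zero ((passiveReward_antitone hA2 k (Nat.zero_le n)).trans
        ((hb ⟨k, rfl⟩).trans (le_max_left _ _)))
    simp [h0]
  have hbdd : BddBelow {g | M.DominatesCycles W g} := ⟨M.R1, fun g hg => hg.R1_le⟩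
  exact ⟨_, hcl.csInf_mem hne hbdd, fun g hg => csInf_le hbdd hg⟩

open Classical in
/-- At the least dominating gain the defining inequality is reversed, once a constant credit is
given to the classes in which passivity never earns less than the gain. -/
lemma exists_credit (hA2 : M.A2) (hg : IsLeast {g | M.DominatesCycles W g} g) :
    ∃ C : ℝ, 0 ≤ C ∧ g ≤ M.R1 + ∑ k, M.pS k *
      (M.totalExcess W g k 0 + if ∀ n, g ≤ M.passiveReward W k n then C else 0) := by
  by_cases hk : ∃ k, 0 < M.pS k ∧ ∀ n, g ≤ M.passiveReward W k n
  · obtain ⟨k, hpos, hk⟩ := hk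
    have hC : 0 ≤ (g - M.R1) / M.pS k := div_nonneg (sub_nonneg.2 hg.1.R1_le) hpos.le
    refine ⟨(g - M.R1) / M.pS k, hC, ?_⟩
    have := Finset.single_le_sum (f := fun k' => M.pS k' * (M.totalExcess W g k' 0 +
        if ∀ n, g ≤ M.passiveReward W k' n then (g - M.R1) / M.pS k else 0))
      (fun k' _ => mul_nonneg (M.pS_nonneg k') (add_nonneg (totalExcess_nonneg 0)
        (by split_ifs <;> simp [hC]))) (Finset.mem_univ k)
    simp only [if_pos hk, mul_add, mul_div_cancel₀ _ hpos.ne'] at this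
    simp only [mul_add]
    linarith [mul_nonneg hpos.le (totalExcess_nonneg (M := M) (W := W) (g := g) (j := k) 0)]
  · push Not at hk
    refine ⟨0, le_rfl, ?_⟩
    simp only [ite_self, add_zero]
    by_contra! hlt
    -- One cut-off `N` beyond which no class that renewals reach has any excess over `g`.
    obtain ⟨N, hN⟩ : ∃ N, ∀ k, 0 < M.pS k → M.passiveReward W k N < g := by
      choose! m hm using hk
      refine ⟨Finset.univ.sup m, fun k hpos => ?_⟩
      exact (passiveReward_antitone hA2 k (Finset.le_sup (Finset.mem_univ k))).trans_lt (hm k hpos)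
    have hF : Continuous fun g' =>
        M.R1 + ∑ k, M.pS k * ∑ n ∈ Finset.range N, M.excess W g' k n :=
      continuous_const.add (continuous_finsetSum _ fun k _ =>
        continuous_const.mul (continuous_finsetSum _ fun n _ => continuous_excess n))
    have hFg : M.R1 + ∑ k, M.pS k * ∑ n ∈ Finset.range N, M.excess W g k n < g := by
      refine lt_of_le_of_lt ?_ hlt
      refine add_le_add_right (Finset.sum_le_sum fun k _ => ?_) _
      rcases (M.pS_nonneg k).eq_or_lt with hk0 | hk0
      · simp [← hk0]
      · refine mul_le_mul_of_nonneg_left ?_ hk0.le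
        simpa [totalExcess] using
          (hg.1.summable_excess hk0).sum_le_tsum _ fun n _ => excess_nonneg n
    -- Both strict inequalities persist for gains slightly below `g`.
    have hev : ∀ᶠ g' in 𝓝[<] g,
        (M.R1 + ∑ k, M.pS k * ∑ n ∈ Finset.range N, M.excess W g' k n < g') ∧
          (∀ k, 0 < M.pS k → M.passiveReward W k N < g') ∧ g' < g := by
      have h1 : ∀ᶠ g' in 𝓝 g,
          M.R1 + ∑ k, M.pS k * ∑ n ∈ Finset.range N, M.excess W g' k n < g' :=
        (hF.tendsto g).eventually_lt tendsto_id hFg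
      have h2 : ∀ᶠ g' in 𝓝 g, ∀ k, 0 < M.pS k → M.passiveReward W k N < g' :=
        eventually_all.2 fun k => eventually_imp_distrib_left.2 fun hpos => lt_mem_nhds (hN k hpos)
      filter_upwards [nhdsWithin_le_nhds h1, nhdsWithin_le_nhds h2, self_mem_nhdsWithin]
        with g' h1 h2 h3 using ⟨h1, h2, h3⟩
    obtain ⟨g', hg'1, hg'2, hg'3⟩ := hev.exists
    suffices hU : M.DominatesCycles W g' from absurd (hg.2 hU) (not_le.2 hg'3)
    refine fun L => le_trans ?_ hg'1.le
    refine add_le_add_right (Finset.sum_le_sum fun k _ => ?_) _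
    rcases (M.pS_nonneg k).eq_or_lt with hk0 | hk0
    · simp [← hk0]
    · refine mul_le_mul_of_nonneg_left ?_ hk0.le
      have hz : ∀ n ∉ Finset.range N, M.excess W g' k n = 0 := fun n hn =>
        excess_eq_zero ((passiveReward_antitone hA2 k (by simpa using hn)).trans (hg'2 k hk0).le)
      rw [← tsum_eq_sum (L := .unconditional ℕ) hz]
      exact (summable_excess hA2 (hg'2 k hk0).le).sum_le_tsum _ fun n _ => excess_nonneg n

/-! ### The upper bound for all policies -/

/-- From the class `j` no policy earns more than a dominating gain `v` that the passive rewards of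
`j` eventually do not exceed. Only `j` and the classes `k` with `pₖˢ > 0` are reachable, and for
these the total excess over `v` converges. -/
lemma averageReward_le_of_dominatesCycles (hA2 : M.A2) (hv : M.DominatesCycles W v) {N : ℕ}
    (hN : M.passiveReward W j N ≤ v) (ψ : Policy K) (τ : ℕ+) :
    M.averageReward W ψ (j, τ) ≤ v := by
  have hsum : ∀ i, i = j ∨ 0 < M.pS i → Summable (M.excess W v i) := by
    rintro i (rfl | hi)
    · exact summable_excess hA2 hN
    · exact hv.summable_excess hi
  refine averageReward_le_of_bellman (I := {x | x.1 = j ∨ 0 < M.pS x.1})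
    (h := fun x => M.totalExcess W v x.1 x.2.natPred) (Or.inl rfl) ?_ ?_
    fun x => totalExcess_nonneg _
  · intro _ x hx a _ y hy
    cases a
    · simp only [next, PMF.support_pure, Set.mem_singleton_iff] at hy
      subst hy
      exact hx
    · exact Or.inr (M.pS_pos_of_mem_support_next_true hy)
  · intro _ x hx a _
    cases a
    · rw [expect_next_false, reward_false, natPred_add_one,
        totalExcess_eq_add (hsum _ hx) x.2.natPred]
      have : M.passiveReward W x.1 x.2.natPred - v ≤ M.excess W v x.1 x.2.natPred :=
        le_max_left _ _
      linarith
    · rw [expect_next_true]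
      have := hv.totalExcess_le
      have h0 := totalExcess_nonneg (M := M) (W := W) (g := v) (j := x.1) x.2.natPred
      simp only [reward, show (1 : ℕ+).natPred = 0 from rfl]
      linarith

/-! ### The threshold policy of a gain -/

variable (M W) in
open Classical in
/-- The thresholds of a gain `g`: the number of states of each class in which the passive reward is
at least `g`, when that reward is nonincreasing. -/
noncomputable def gainThreshold (g : ℝ) (j : Fin K) : ℕ∞ :=
  if h : ∃ n, M.passiveReward W j n < g then (Nat.find h : ℕ∞) else ⊤

lemma gainThreshold_eq_top_iff :
    M.gainThreshold W g j = ⊤ ↔ ∀ n, g ≤ M.passiveReward W j n := by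
  classical
  unfold gainThreshold
  split_ifs with h
  · simpa using h
  · simpa using h

lemma gainThreshold_lt_iff (hA2 : M.A2) (τ : ℕ+) :
    M.gainThreshold W g j < ((τ : ℕ) : ℕ∞) ↔ M.passiveReward W j τ.natPred < g := by
  classical
  unfold gainThreshold
  split_ifs with h
  · rw [Nat.cast_lt, ← PNat.natPred_add_one τ, Nat.lt_succ_iff, Nat.find_le_iff]
    exact ⟨fun ⟨m, hm, hlt⟩ => (passiveReward_antitone hA2 j hm).trans_lt hlt,
      fun hlt => ⟨_, le_rfl, hlt⟩⟩
  · simpa using not_lt.1 (not_exists.1 h τ.natPred)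

open Classical in
/-- The thresholds of the least dominating gain earn that gain from every state, also from the
classes where the total excess diverges. -/
lemma le_averageReward_thresholdPolicy (hA2 : M.A2)
    (hg : IsLeast {g | M.DominatesCycles W g} g) (x₀ : State K) :
    (g : EReal) ≤ M.averageReward W (thresholdPolicy (M.gainThreshold W g)) x₀ := by
  obtain ⟨C, hC, hCg⟩ := exists_credit hA2 hg
  obtain ⟨B, hB⟩ := (Set.finite_range fun k => M.totalExcess W g k 0).bddAbove
  have hle : ∀ k n, M.totalExcess W g k n ≤ M.totalExcess W g k 0 := by
    intro k n
    by_cases hs : Summable (M.excess W g k)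
    · exact totalExcess_le hs n
    · simp [totalExcess_eq_zero_of_not_summable hs]
  refine le_averageReward_of_bellman (I := Set.univ) (B := B + C)
    (h := fun x => M.totalExcess W g x.1 x.2.natPred +
      if ∀ n, g ≤ M.passiveReward W x.1 n then C else 0) (Set.mem_univ _)
    (fun _ _ _ _ _ => Set.subset_univ _) ?_ ?_
  · intro _ x _ a ha
    simp only [thresholdPolicy, PMF.support_pure, Set.mem_singleton_iff] at ha
    subst ha
    by_cases hx : M.passiveReward W x.1 x.2.natPred < g
    · rw [decide_eq_true ((gainThreshold_lt_iff hA2 _).2 hx), expect_next_true,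
        totalExcess_eq_zero hA2 hx.le, if_neg fun hn => not_lt.2 (hn _) hx]
      simpa only [add_zero, reward, show (1 : ℕ+).natPred = 0 from rfl] using hCg
    · rw [decide_eq_false (mt (gainThreshold_lt_iff hA2 _).1 hx), expect_next_false, reward_false,
        natPred_add_one]
      rw [not_lt] at hx
      dsimp only
      by_cases hs : Summable (M.excess W g x.1)
      · rw [totalExcess_eq_add hs x.2.natPred, excess, max_eq_left (sub_nonneg.2 hx)]
        linarith
      -- Where the total excess diverges its value is `0`, and passivity earns at least `g` anyway.
      · simp only [totalExcess_eq_zero_of_not_summable hs]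
        linarith
  · intro x
    have h1 := (hle x.1 x.2.natPred).trans (hB ⟨x.1, rfl⟩)
    have h2 : (if ∀ n, g ≤ M.passiveReward W x.1 n then C else 0) ≤ C := by
      split_ifs
      · exact le_rfl
      · exact hC
    exact add_le_add h1 h2

/-- A threshold policy that never leaves the class `j` earns at least `⨅ n, q j n` in every slot;
this is the best possible if `q j` never falls below a dominating gain. -/
lemma isOptimalFrom_of_eq_top (hA2 : M.A2) (hg : M.DominatesCycles W g)
    (hj : ∀ n, g ≤ M.passiveReward W j n) {Γ : Fin K → ℕ∞} (hΓ : Γ j = ⊤) (τ : ℕ+) :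
    M.IsOptimalFrom W (thresholdPolicy Γ) (j, τ) := by
  intro ψ
  have hbdd : BddBelow (Set.range (M.passiveReward W j)) := ⟨g, by rintro _ ⟨n, rfl⟩; exact hj n⟩
  have hlow : ((⨅ n, M.passiveReward W j n : ℝ) : EReal) ≤
      M.averageReward W (thresholdPolicy Γ) (j, τ) := by
    refine le_averageReward_of_bellman (I := {x | x.1 = j}) (h := fun _ => 0) (B := 0) rfl ?_ ?_
      fun _ => le_rfl
    · intro _ x hx a ha y hy
      obtain rfl : x.1 = j := hx
      simp only [thresholdPolicy, PMF.support_pure, Set.mem_singleton_iff, hΓ, not_top_lt,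
        decide_false] at ha
      subst ha
      simp only [next, PMF.support_pure, Set.mem_singleton_iff] at hy
      subst hy
      rfl
    · intro _ x hx a ha
      obtain rfl : x.1 = j := hx
      simp only [thresholdPolicy, PMF.support_pure, Set.mem_singleton_iff, hΓ, not_top_lt,
        decide_false] at ha
      subst ha
      rw [expect_next_false, reward_false]
      simpa using ciInf_le hbdd x.2.natPred
  refine le_trans ?_ hlow
  refine EReal.le_of_forall_lt_iff_le.1 fun v hv => ?_
  rw [EReal.coe_lt_coe_iff] at hv
  obtain ⟨N, hN⟩ := exists_lt_of_ciInf_lt hv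
  exact averageReward_le_of_dominatesCycles hA2 (hg.mono ((hj N).trans hN.le)) hN.le ψ τ

end Arm

end PilotArm

theorem theorem2 {K : ℕ} (M : PilotArm.Arm K) (hA1 : M.A1) (hA2 : M.A2) (W : ℝ) :
    ∃ Γ : Fin K → ℕ∞,
      M.IsOptimal W (PilotArm.thresholdPolicy Γ) ∧
      ∀ j : Fin K, Γ j = ⊤ →
        ∀ τ : ℕ+, M.IsOptimalFrom W (PilotArm.thresholdPolicy fun _ => ⊤) (j, τ) := by
  obtain ⟨g, hg⟩ := PilotArm.Arm.exists_isLeast_dominatesCycles (W := W) hA2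
  refine ⟨M.gainThreshold W g, ?_, fun j hj τ => ?_⟩
  · rintro ⟨j, τ⟩
    by_cases hj : M.gainThreshold W g j = ⊤
    · exact PilotArm.Arm.isOptimalFrom_of_eq_top hA2 hg.1
        (PilotArm.Arm.gainThreshold_eq_top_iff.1 hj) hj τ
    · rw [PilotArm.Arm.gainThreshold_eq_top_iff] at hj
      push Not at hj
      obtain ⟨N, hN⟩ := hj
      exact fun ψ =>
        (PilotArm.Arm.averageReward_le_of_dominatesCycles hA2 hg.1 hN.le ψ τ).trans
          (PilotArm.Arm.le_averageReward_thresholdPolicy hA2 hg _)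
  · exact PilotArm.Arm.isOptimalFrom_of_eq_top hA2 hg.1
      (PilotArm.Arm.gainThreshold_eq_top_iff.1 hj) rfl τ
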